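/- Consider a stochastic game with a finite set $\mathcal N$ of agents, a finite set $\mathcal S$ of states, finite nonempty action sets $\mathcal A_j$ ($j\in\mathcal N$), $\mathcal A=\prod_j \mathcal A_j$, transition law $T:\mathcal S\times\mathcal A\to\Delta(\mathcal S)$, real rewards $R_j:\mathcal S\times\mathcal A\to\mathbb R$, and a discount factor $\gamma\in[0,1)$. At every step the agents observe the current state and the complete history of past states and joint actions, and then choose their actions independently of each other. An infinite-memory strategy of agent $j$ is a map $\pi_j:(\mathcal S\times\mathcal A)^*\times\mathcal S\to\Delta(\mathcal A_j)$ from complete histories and current states to distributions over actions; $\Pi_j^\infty$ is the set of all of them. For an integer $K\ge 0$, a $K$-memory strategy of agent $j$ is a map $\pi_j:\bigcup_{k=0}^K(\mathcal S\times\mathcal A)^k\times\mathcal S\to\Delta(\mathcal A_j)$; it is regarded as the element of $\Pi_j^\infty$ that at a history $H$ of length $t$ applies $\pi_j$ to the latest $\min\{K,t\}$ steps of $H$ and the current state. It is pure if each of its values is a point mass. For a strategy profile $(\pi_i,\pi_{-i})$ and an initial state $S$, let $$u_i(S;\pi_i,\pi_{-i})=\mathbb E_{(\pi_i,\pi_{-i})}\Big[\sum_{t=0}^\infty\gamma^t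 R_i(S_t,a_t)\,\Big|\,S_0=S\Big],$$ where $S_t$ and $a_t$ are the state and the joint action at step $t$. Theorem. Let $i\in\mathcal N$, let $K\ge 0$ be an integer, and let every agent $j\ne i$ use a $K$-memory strategy $\pi_j$. Then there is a pure $K$-memory strategy $\pi_i^*$ of agent $i$ that is a best response to $\pi_{-i}$, that is, $$u_i(S;\pi_i^*,\pi_{-i})\ \ge\ u_i(S;\pi_i',\pi_{-i})\qquad\text{for all } S\in\mathcal S \text{ and all } \pi_i'\in\Pi_i^\infty.$$ -/

import Mathlib

open MeasureTheory ProbabilityTheory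

/-- The data of a stochastic game with agents `N`, states `S` and action sets `A j`: the transition
law over next states and the immediate reward of every agent, as functions of the current state
and of the joint action. -/
structure StochasticGame (N S : Type*) (A : N → Type*) where
  transition : S → (∀ j, A j) → PMF S
  reward : N → S → (∀ j, A j) → ℝ

namespace StochasticGame

/-- One step of play: a state together with the joint action taken in it. -/
def Step {N : Type*} (S : Type*) (A : N → Type*) : Type _ := S × (∀ j, A j)

/-- A (finite) history of play, oldest step first. -/
abbrev History {N : Type*} (S : Type*) (A : N → Type*) : Type _ := List (Step S A)

/-- Histories of length at most `K`. -/
abbrev BoundedHistory {N : Type*} (S : Type*) (A : N → Type*) (K : ℕ) : Type _ :=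
  {h : History S A // h.length ≤ K}

/-- Infinite-memory (behavioral) strategies of agent `i`: maps from complete histories and current
states to distributions over the actions of `i`. -/
abbrev Strategy {N : Type*} (S : Type*) (A : N → Type*) (i : N) : Type _ :=
  History S A → S → PMF (A i)

/-- `K`-memory (behavioral) strategies of agent `i`: maps from histories of length at most `K` and
current states to distributions over the actions of `i`. -/
abbrev MemStrategy {N : Type*} (S : Type*) (A : N → Type*) (K : ℕ) (i : N) : Type _ :=
  BoundedHistory S A K → S → PMF (A i)

section Strategies

variable {N S : Type*} {A : N → Type*}

/-- The latest `min K h.length` steps of the history `h`. -/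
def History.recent (K : ℕ) (h : History S A) : BoundedHistory S A K :=
  ⟨h.drop (h.length - K), by rw [List.length_drop]; omega⟩

/-- A `K`-memory strategy, viewed as an infinite-memory strategy: at every history it looks only at
the latest (at most `K`) steps. -/
def MemStrategy.toStrategy {K : ℕ} {i : N} (π : MemStrategy S A K i) : Strategy S A i :=
  fun h s => π (h.recent K) s

/-- A `K`-memory strategy is pure if it never randomizes. -/
def MemStrategy.IsPure {K : ℕ} {i : N} (π : MemStrategy S A K i) : Prop :=
  ∀ h s, ∃ a : A i, π h s = PMF.pure a

/-- The full strategy profile in which agent `i` uses `σ` and the other agents use `π`. -/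
def profile [DecidableEq N] (i : N) (σ : Strategy S A i) (π : ∀ j : {j : N // j ≠ i}, Strategy S A j) :
    ∀ j, Strategy S A j :=
  fun j => if h : j = i then h.symm ▸ σ else π ⟨j, h⟩

end Strategies

section Play

variable {N S : Type*} {A : N → Type*}

instance : MeasurableSpace (Step S A) := ⊤

instance : DiscreteMeasurableSpace (Step S A) := ⟨fun _ => trivial⟩

instance [Finite N] [Finite S] [∀ j, Finite (A j)] : Finite (Step S A) :=
  inferInstanceAs (Finite (S × (∀ j, A j)))

variable [Fintype N] [DecidableEq N] [∀ j, Fintype (A j)]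

/-- The distribution of a joint action whose components are drawn independently. -/
noncomputable def independent (p : ∀ j, PMF (A j)) : PMF (∀ j, A j) :=
  PMF.ofFintype (fun a => ∏ j, p j (a j)) (by
    rw [← Fintype.prod_sum (fun j (b : A j) => p j b)]
    refine Finset.prod_eq_one fun j _ => ?_
    rw [← tsum_fintype (L := SummationFilter.unconditional _)]
    exact (p j).tsum_coe)

/-- The distribution of the step taken at state `s` after history `h` under the profile `π`. -/
noncomputable def stepAt (π : ∀ j, Strategy S A j) (h : History S A) (s : S) : PMF (Step S A) :=
  (independent fun j => π j h s).map fun a => ((s, a) : Step S A)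

/-- The history formed by the steps `0, …, n`. -/
def historyOf {n : ℕ} (x : Finset.Iic n → Step S A) : History S A :=
  List.ofFn fun t : Fin (n + 1) => x ⟨t, Finset.mem_Iic.2 (Nat.lt_succ_iff.1 t.2)⟩

variable [Fintype S]

/-- The conditional law of step `n + 1` given the steps `0, …, n`: the next state is drawn from the
transition law, and then the agents act independently, knowing the history and this state. -/
noncomputable def stepKernel (G : StochasticGame N S A) (π : ∀ j, Strategy S A j) (n : ℕ) :
    Kernel (Finset.Iic n → Step S A) (Step S A) where
  toFun x :=
    let last := x ⟨n, Finset.mem_Iic.2 le_rfl⟩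
    ((G.transition last.1 last.2).bind fun s => stepAt π (historyOf x) s).toMeasure
  measurable' := Measurable.of_discrete

instance (G : StochasticGame N S A) (π : ∀ j, Strategy S A j) (n : ℕ) :
    IsMarkovKernel (G.stepKernel π n) :=
  ⟨fun _ => PMF.toMeasure.isProbabilityMeasure _⟩

/-- The law of the infinite play `(S₀, a₀), (S₁, a₁), …` under the profile `π` from the initial
state `s`. -/
noncomputable def playMeasure (G : StochasticGame N S A) (π : ∀ j, Strategy S A j) (s : S) :
    Measure (ℕ → Step S A) :=
  Kernel.trajMeasure (X := fun _ => Step S A) (stepAt π [] s).toMeasure (G.stepKernel π)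

/-- The utility of agent `i`: the expected discounted sum of its rewards. -/
noncomputable def utility (G : StochasticGame N S A) (γ : ℝ) (i : N) (s : S)
    (π : ∀ j, Strategy S A j) : ℝ :=
  ∫ x, ∑' t : ℕ, γ ^ t * G.reward i (x t).1 (x t).2 ∂(G.playMeasure π s)

/-- `σ` is a best response of agent `i` to the strategies `π` of the other agents: from every
initial state, it does at least as well as every infinite-memory strategy of agent `i`. -/
def IsBestResponse (G : StochasticGame N S A) (γ : ℝ) (i : N) (σ : Strategy S A i)
    (π : ∀ j : {j : N // j ≠ i}, Strategy S A j) : Prop :=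
  ∀ (s : S) (σ' : Strategy S A i),
    G.utility γ i s (profile i σ' π) ≤ G.utility γ i s (profile i σ π)

end Play

end StochasticGame

/-! Against `K`-memory opponents, the pair (latest at most `K` steps, current state) is a finite
Markov decision process for agent `i`: the pair and the action of `i` determine the law of the
reward and of the next pair (`History.recent_append_singleton`). Its Bellman operator contracts,
which gives an optimal value `V` and a greedy action at each pair.

Deviations that use the whole history need no reduction to this process. Lift `V` to all histories;
`hasSum_bellman_residual` writes the lifted value minus the utility of any profile as a discounted
sum of expected Bellman residuals. These are nonnegative whatever `i` does and vanish for the greedy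
strategy. -/

/-- A family of Bellman functionals that contract uniformly has an optimal value function, and the
maximum is attained everywhere. -/
theorem exists_bellman_fixedPoint {X B : Type*} [Finite X] [Finite B] [Nonempty B]
    (L : X → B → (X → ℝ) → ℝ) (γ : ℝ) (hγ0 : 0 ≤ γ) (hγ1 : γ < 1)
    (hL : ∀ x b V W c, (∀ y, |V y - W y| ≤ c) → |L x b V - L x b W| ≤ γ * c) :
    ∃ V : X → ℝ, ∀ x, (∀ b, L x b V ≤ V x) ∧ ∃ b, L x b V = V x := by
  have := Fintype.ofFinite X
  let T : (X → ℝ) → X → ℝ := fun V x => ⨆ b, L x b V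
  have hbdd : ∀ x V, BddAbove (Set.range fun b => L x b V) := fun x V => (Set.finite_range _).bddAbove
  -- A one-sided bound suffices: exchanging `V` and `W` gives the other side.
  have hT1 : ∀ V W x c, (∀ y, |V y - W y| ≤ c) → T V x ≤ T W x + γ * c := by
    intro V W x c h
    refine ciSup_le fun b => ?_
    have h1 := (abs_le.1 (hL x b V W c h)).2
    have h2 : L x b W ≤ T W x := le_ciSup (hbdd x W) b
    linarith
  have hT : ContractingWith ⟨γ, hγ0⟩ T := by
    refine ⟨by exact_mod_cast hγ1, LipschitzWith.of_dist_le_mul fun V W => ?_⟩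
    refine (dist_pi_le_iff (mul_nonneg hγ0 dist_nonneg)).2 fun x => ?_
    have hd : ∀ V W : X → ℝ, ∀ y, |V y - W y| ≤ dist V W := fun V W y => by
      rw [← Real.dist_eq]; exact dist_le_pi_dist V W y
    rw [Real.dist_eq, abs_le]
    have h1 := hT1 V W x _ (hd V W)
    have h2 := hT1 W V x _ (hd W V)
    rw [dist_comm W V] at h2
    change -(γ * dist V W) ≤ _ ∧ _ ≤ γ * dist V W
    constructor <;> linarith
  have hfix : T hT.fixedPoint = hT.fixedPoint := hT.fixedPoint_isFixedPt
  refine ⟨hT.fixedPoint, fun x => ⟨fun b => ?_, ?_⟩⟩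
  · rw [← congrFun hfix x]
    exact le_ciSup (hbdd x _) b
  · obtain ⟨b, hb⟩ := exists_eq_ciSup_of_finite (f := fun b => L x b hT.fixedPoint)
    exact ⟨b, hb.trans (congrFun hfix x)⟩

/-! ### Expectations over finite types -/

namespace PMF

/-- The expectation of a real function under a distribution on a finite type. -/
noncomputable def expect {α : Type*} [Fintype α] (p : PMF α) (f : α → ℝ) : ℝ :=
  ∑ a, (p a).toReal * f a

section Expect

variable {α β : Type*} [Fintype α] [Fintype β]

theorem sum_toReal_eq_one (p : PMF α) : ∑ a, (p a).toReal = 1 := by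
  rw [← ENNReal.toReal_sum fun a _ => p.apply_ne_top a,
    ← tsum_fintype (L := SummationFilter.unconditional _), p.tsum_coe, ENNReal.toReal_one]

theorem expect_mono (p : PMF α) {f g : α → ℝ} (h : ∀ a, f a ≤ g a) : p.expect f ≤ p.expect g :=
  Finset.sum_le_sum fun a _ => mul_le_mul_of_nonneg_left (h a) ENNReal.toReal_nonneg

theorem expect_const (p : PMF α) (c : ℝ) : p.expect (fun _ => c) = c := by
  rw [expect, ← Finset.sum_mul, sum_toReal_eq_one, one_mul]

theorem expect_sub (p : PMF α) (f g : α → ℝ) :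
    p.expect (fun a => f a - g a) = p.expect f - p.expect g := by
  simp only [expect, mul_sub, Finset.sum_sub_distrib]

theorem abs_expect_le (p : PMF α) {f : α → ℝ} {c : ℝ} (h : ∀ a, |f a| ≤ c) : |p.expect f| ≤ c := by
  rw [abs_le]
  constructor
  · rw [← p.expect_const (-c)]
    exact p.expect_mono fun a => (abs_le.1 (h a)).1
  · rw [← p.expect_const c]
    exact p.expect_mono fun a => (abs_le.1 (h a)).2

theorem expect_pure (a : α) (f : α → ℝ) : (PMF.pure a).expect f = f a := by
  classical
  rw [expect, Finset.sum_eq_single a] <;> simp +contextual [PMF.pure_apply]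

theorem expect_bind (p : PMF α) (q : α → PMF β) (f : β → ℝ) :
    (p.bind q).expect f = p.expect fun a => (q a).expect f := by
  have h : ∀ b, ((p.bind q) b).toReal = ∑ a, (p a).toReal * (q a b).toReal := fun b => by
    rw [PMF.bind_apply, tsum_fintype, ENNReal.toReal_sum fun a _ =>
      ENNReal.mul_ne_top (p.apply_ne_top a) ((q a).apply_ne_top b)]
    simp only [ENNReal.toReal_mul]
  simp only [expect, h, Finset.sum_mul, Finset.mul_sum]
  rw [Finset.sum_comm]
  simp only [mul_assoc]

theorem expect_map (p : PMF α) (g : α → β) (f : β → ℝ) :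
    (p.map g).expect f = p.expect fun a => f (g a) := by
  rw [← PMF.bind_pure_comp, expect_bind]
  simp only [Function.comp_apply, expect_pure]

theorem integral_eq_expect [MeasurableSpace α] [MeasurableSingletonClass α] (p : PMF α)
    (f : α → ℝ) : ∫ a, f a ∂p.toMeasure = p.expect f := by
  simp only [PMF.integral_eq_sum, smul_eq_mul, expect]

end Expect

end PMF

/-! ### Memory truncation and profiles -/

namespace StochasticGame

section Strategies

variable {N S : Type*} {A : N → Type*}

/-- The steps of `h` that survive truncation after appending `y` already lie in its latest `K`, so
the memory can be updated without the full history. -/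
theorem History.recent_append_singleton (K : ℕ) (h : History S A) (y : Step S A) :
    History.recent K (h ++ [y]) = History.recent K ((h.recent K).1 ++ [y]) := by
  apply Subtype.ext
  simp only [History.recent, List.length_append, List.length_drop, List.length_singleton]
  rcases Nat.lt_or_ge h.length K with hK | hK
  · simp [Nat.sub_eq_zero_of_le hK.le]
  · rw [Nat.sub_sub_self hK, List.drop_append, List.drop_append, List.drop_drop, List.length_drop]
    congr 2 <;> omega

theorem History.recent_recent (K : ℕ) (h : History S A) :
    History.recent K (h.recent K).1 = h.recent K := by
  apply Subtype.ext
  have h0 : (h.drop (h.length - K)).length - K = 0 := by rw [List.length_drop]; omega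
  simp only [History.recent, h0, List.drop_zero]

theorem profile_self [DecidableEq N] (i : N) (σ : Strategy S A i)
    (π : ∀ j : {j : N // j ≠ i}, Strategy S A j) : profile i σ π i = σ := by
  simp [profile]

theorem profile_of_ne [DecidableEq N] (i : N) (σ : Strategy S A i)
    (π : ∀ j : {j : N // j ≠ i}, Strategy S A j) {j : N} (hj : j ≠ i) :
    profile i σ π j = π ⟨j, hj⟩ := by
  simp [profile, hj]

theorem update_profile_apply [DecidableEq N] (i : N) (σ : Strategy S A i)
    (π : ∀ j : {j : N // j ≠ i}, Strategy S A j) (h : History S A) (s : S) (p : PMF (A i)) :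
    Function.update (fun j => profile i σ π j h s) i p =
      fun j => profile i (fun _ _ => p) π j h s := by
  funext j
  rcases eq_or_ne j i with rfl | hj
  · simp [profile_self]
  · simp [hj, profile_of_ne]

instance [Finite N] [Finite S] [∀ j, Finite (A j)] (K : ℕ) : Finite (BoundedHistory S A K) :=
  (List.finite_length_le (Step S A) K).to_subtype

end Strategies

/-! ### Stage expectations and the performance difference formula -/

section Play

variable {N S : Type*} {A : N → Type*} [Fintype N] [DecidableEq N] [∀ j, Fintype (A j)]

noncomputable instance [Fintype S] : Fintype (Step S A) :=
  inferInstanceAs (Fintype (S × (∀ j, A j)))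

theorem independent_apply (p : ∀ j, PMF (A j)) (a : ∀ j, A j) :
    independent p a = ∏ j, p j (a j) := rfl

/-- Makes expected payoffs affine in the mixed action of agent `i`, so that bounds at pure actions
are enough. -/
theorem independent_eq_bind (p : ∀ j, PMF (A j)) (i : N) :
    independent p = (p i).bind fun b => independent (Function.update p i (PMF.pure b)) := by
  classical
  ext a
  have h : ∀ b, independent (Function.update p i (PMF.pure b)) a =
      (PMF.pure b : PMF (A i)) (a i) * ∏ j ∈ Finset.univ.erase i, p j (a j) := fun b => by
    rw [independent_apply, ← Finset.mul_prod_erase _ _ (Finset.mem_univ i), Function.update_self]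
    congr 1
    refine Finset.prod_congr rfl fun j hj => ?_
    rw [Function.update_of_ne (Finset.ne_of_mem_erase hj)]
  rw [PMF.bind_apply, tsum_fintype, independent_apply,
    ← Finset.mul_prod_erase _ _ (Finset.mem_univ i)]
  simp only [h, ← mul_assoc, ← Finset.sum_mul]
  congr 1
  simp [PMF.pure_apply]

variable [Fintype S]

theorem expect_stepAt (π : ∀ j, Strategy S A j) (h : History S A) (s : S) (f : Step S A → ℝ) :
    (stepAt π h s).expect f = (independent fun j => π j h s).expect fun a => f (s, a) :=
  PMF.expect_map _ _ _

/-- The history formed by the first `n` steps of a play. -/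
def prefixHistory (n : ℕ) (x : ℕ → Step S A) : History S A :=
  List.ofFn fun t : Fin n => x t

omit [Fintype N] [DecidableEq N] [∀ j, Fintype (A j)] [Fintype S] in
theorem prefixHistory_succ (n : ℕ) (x : ℕ → Step S A) :
    prefixHistory (n + 1) x = prefixHistory n x ++ [x n] := by
  rw [prefixHistory, List.ofFn_succ', List.concat_eq_append]
  rfl

variable (G : StochasticGame N S A) (π : ∀ j, Strategy S A j) (s : S)

instance : IsProbabilityMeasure (G.playMeasure π s) := by
  have : IsProbabilityMeasure (stepAt π [] s).toMeasure := PMF.toMeasure.isProbabilityMeasure _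
  unfold playMeasure
  infer_instance

/-- Finitely many steps take only finitely many values. -/
theorem integrable_prefix (n : ℕ) (f : (Fin n → Step S A) → ℝ) :
    Integrable (fun x => f fun t => x t) (G.playMeasure π s) := by
  have hm : Measurable fun (x : ℕ → Step S A) (t : Fin n) => x t :=
    measurable_pi_lambda _ fun t => measurable_pi_apply _
  exact (Integrable.of_finite (μ := (G.playMeasure π s).map _) (f := f)).comp_measurable hm

/-- The expectation of `J h s`, where `h` is the history of the first `n` steps and `s` is the state
after them. -/
noncomputable def stage (J : History S A → S → ℝ) : ℕ → ℝ
  | 0 => J [] s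
  -- The state after `n + 1` steps is averaged by the transition law, so the integrand depends on
  -- those steps alone.
  | n + 1 => ∫ x, (G.transition (x n).1 (x n).2).expect (J (prefixHistory (n + 1) x))
      ∂(G.playMeasure π s)

theorem stage_integrand_integrable (J : History S A → S → ℝ) (n : ℕ) :
    Integrable (fun x => (G.transition (x n).1 (x n).2).expect (J (prefixHistory (n + 1) x)))
      (G.playMeasure π s) :=
  G.integrable_prefix π s (n + 1) fun w =>
    (G.transition (w (Fin.last n)).1 (w (Fin.last n)).2).expect (J (List.ofFn w))

theorem stage_mono {J J' : History S A → S → ℝ} (h : ∀ l t, J l t ≤ J' l t) (n : ℕ) :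
    G.stage π s J n ≤ G.stage π s J' n := by
  cases n with
  | zero => exact h _ _
  | succ n =>
    exact integral_mono (G.stage_integrand_integrable π s J n)
      (G.stage_integrand_integrable π s J' n) fun x => PMF.expect_mono _ (h _)

theorem stage_sub (J J' : History S A → S → ℝ) (n : ℕ) :
    G.stage π s (fun l t => J l t - J' l t) n = G.stage π s J n - G.stage π s J' n := by
  cases n with
  | zero => rfl
  | succ n =>
    simp only [stage, PMF.expect_sub]
    exact integral_sub (G.stage_integrand_integrable π s J n)
      (G.stage_integrand_integrable π s J' n)

theorem stage_const (c : ℝ) (n : ℕ) : G.stage π s (fun _ _ => c) n = c := by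
  cases n with
  | zero => rfl
  | succ n => simp [stage, PMF.expect_const]

theorem abs_stage_le {J : History S A → S → ℝ} {C : ℝ} (h : ∀ l t, |J l t| ≤ C) (n : ℕ) :
    |G.stage π s J n| ≤ C := by
  rw [abs_le]
  constructor
  · rw [← G.stage_const π s (-C) n]
    exact G.stage_mono π s (fun l t => (abs_le.1 (h l t)).1) n
  · rw [← G.stage_const π s C n]
    exact G.stage_mono π s (fun l t => (abs_le.1 (h l t)).2) n

theorem integral_step_zero (f : Step S A → ℝ) :
    ∫ x, f (x 0) ∂(G.playMeasure π s) = (stepAt π [] s).expect f := by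
  have : IsProbabilityMeasure (stepAt π [] s).toMeasure := PMF.toMeasure.isProbabilityMeasure _
  have hmap : (G.playMeasure π s).map (fun x => x 0) = (stepAt π [] s).toMeasure := by
    have h0 : (fun x : ℕ → Step S A => x 0) = (fun w => w ⟨0, Finset.mem_Iic.2 le_rfl⟩) ∘
        Preorder.frestrictLe (π := fun _ => Step S A) 0 := rfl
    rw [h0, ← Measure.map_map (by fun_prop) (by fun_prop), playMeasure, Kernel.trajMeasure,
      Measure.map_comp _ _ (by fun_prop), Kernel.traj_map_frestrictLe, Kernel.partialTraj_self,
      Measure.id_comp, Measure.map_map (by fun_prop) (by fun_prop)]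
    exact Measure.map_id
  rw [← PMF.integral_eq_expect, ← hmap, integral_map (measurable_pi_apply 0).aemeasurable
    Measurable.of_discrete.aestronglyMeasurable]

theorem integral_step_succ (n : ℕ) (F : History S A → Step S A → ℝ) :
    ∫ x, F (prefixHistory (n + 1) x) (x (n + 1)) ∂(G.playMeasure π s) =
      ∫ x, (G.transition (x n).1 (x n).2).expect (fun t =>
        (stepAt π (prefixHistory (n + 1) x) t).expect (F (prefixHistory (n + 1) x)))
        ∂(G.playMeasure π s) := by
  have : IsProbabilityMeasure (stepAt π [] s).toMeasure := PMF.toMeasure.isProbabilityMeasure _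
  have h := Kernel.map_frestrictLe_trajMeasure_compProd_eq_map_trajMeasure
    (X := fun _ => Step S A) (μ₀ := (stepAt π [] s).toMeasure) (κ := G.stepKernel π) (a := n)
  -- The law of a prefix with its next step is a composition product, so the integral disintegrates
  -- along `stepKernel`.
  have h' := congrArg (fun μ => ∫ z, F (historyOf z.1) z.2 ∂μ) h
  rw [integral_map (by fun_prop) Measurable.of_discrete.aestronglyMeasurable,
    Measure.integral_compProd .of_finite,
    integral_map (by fun_prop) Measurable.of_discrete.aestronglyMeasurable] at h'
  refine h'.symm.trans (integral_congr_ae (.of_forall fun x => ?_))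
  refine (PMF.integral_eq_expect _ _).trans ?_
  rw [PMF.expect_bind]
  rfl

theorem integral_step (n : ℕ) (F : History S A → Step S A → ℝ) :
    ∫ x, F (prefixHistory n x) (x n) ∂(G.playMeasure π s) =
      G.stage π s (fun h t => (stepAt π h t).expect (F h)) n := by
  cases n with
  | zero => exact G.integral_step_zero π s (F [])
  | succ n => exact G.integral_step_succ π s n F

theorem integral_reward_add (γ : ℝ) (i : N) (Q : History S A → S → ℝ) (n : ℕ) :
    ∫ x, G.reward i (x n).1 (x n).2 ∂(G.playMeasure π s) + γ * G.stage π s Q (n + 1) =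
      G.stage π s (fun h t => (stepAt π h t).expect fun y =>
        G.reward i y.1 y.2 + γ * (G.transition y.1 y.2).expect (Q (h ++ [y]))) n := by
  rw [← G.integral_step π s n (fun h y =>
      G.reward i y.1 y.2 + γ * (G.transition y.1 y.2).expect (Q (h ++ [y]))), stage,
    ← integral_const_mul, ← integral_add]
  · simp only [prefixHistory_succ]
  · exact G.integrable_prefix π s (n + 1) fun w =>
      G.reward i (w (Fin.last n)).1 (w (Fin.last n)).2
  · exact (G.stage_integrand_integrable π s Q n).const_mul γ

/-- Rewards are bounded by finiteness, so a geometric majorant lets sum and integral be exchanged.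
-/
theorem hasSum_utility {γ : ℝ} (hγ0 : 0 ≤ γ) (hγ1 : γ < 1) (i : N) :
    HasSum (fun n => γ ^ n * ∫ x, G.reward i (x n).1 (x n).2 ∂(G.playMeasure π s))
      (G.utility γ i s π) := by
  obtain ⟨C, hC⟩ : ∃ C, ∀ y : Step S A, |G.reward i y.1 y.2| ≤ C := by
    obtain ⟨C, hC⟩ := (Set.finite_range fun y : Step S A => |G.reward i y.1 y.2|).bddAbove
    exact ⟨C, fun y => hC ⟨y, rfl⟩⟩
  have hint : ∀ n, Integrable (fun x => γ ^ n * G.reward i (x n).1 (x n).2)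
      (G.playMeasure π s) := fun n =>
    G.integrable_prefix π s (n + 1) fun w =>
      γ ^ n * G.reward i (w (Fin.last n)).1 (w (Fin.last n)).2
  have h := hasSum_integral_of_summable_integral_norm hint ?_
  · have hfun : (fun n => γ ^ n * ∫ x, G.reward i (x n).1 (x n).2 ∂(G.playMeasure π s)) =
        fun n => ∫ x, γ ^ n * G.reward i (x n).1 (x n).2 ∂(G.playMeasure π s) :=
      funext fun n => (integral_const_mul _ _).symm
    rw [hfun]
    exact h
  · refine Summable.of_nonneg_of_le (fun n => integral_nonneg fun x => norm_nonneg _) (fun n => ?_)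
      ((summable_geometric_of_lt_one hγ0 hγ1).mul_right C)
    have hle : ∀ x : ℕ → Step S A, ‖γ ^ n * G.reward i (x n).1 (x n).2‖ ≤ γ ^ n * C := fun x => by
      rw [Real.norm_eq_abs, abs_mul, abs_of_nonneg (pow_nonneg hγ0 n)]
      exact mul_le_mul_of_nonneg_left (hC _) (pow_nonneg hγ0 n)
    refine (integral_mono (hint n).norm (integrable_const _) hle).trans_eq ?_
    simp

/-- The performance difference formula: the gap between a value function `Q` and the utility of a
profile is the expected discounted sum of the Bellman residuals of `Q` along the play. -/
theorem hasSum_bellman_residual {γ : ℝ} (hγ0 : 0 ≤ γ) (hγ1 : γ < 1) (i : N)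
    (Q : History S A → S → ℝ) {C : ℝ} (hQ : ∀ h t, |Q h t| ≤ C) :
    HasSum (fun n => γ ^ n * G.stage π s (fun h t => Q h t - (stepAt π h t).expect fun y =>
        G.reward i y.1 y.2 + γ * (G.transition y.1 y.2).expect (Q (h ++ [y]))) n)
      (Q [] s - G.utility γ i s π) := by
  have hsum : Summable fun n => γ ^ n * G.stage π s Q n := by
    refine Summable.of_norm_bounded ((summable_geometric_of_lt_one hγ0 hγ1).mul_right C) fun n => ?_
    rw [Real.norm_eq_abs, abs_mul, abs_of_nonneg (pow_nonneg hγ0 n)]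
    exact mul_le_mul_of_nonneg_left (G.abs_stage_le π s hQ n) (pow_nonneg hγ0 n)
  have h1 := hsum.hasSum
  -- Telescoping: the series minus its shift leaves only the term at `0`, which is `Q [] s`.
  have h2 := (hasSum_nat_add_iff' 1).2 h1
  have h3 := (h1.sub h2).sub (G.hasSum_utility π s hγ0 hγ1 i)
  have hval : ∑' n, γ ^ n * G.stage π s Q n - (∑' n, γ ^ n * G.stage π s Q n -
      ∑ n ∈ Finset.range 1, γ ^ n * G.stage π s Q n) = Q [] s := by
    simp [stage]
  rw [hval] at h3
  refine h3.congr_fun fun n => ?_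
  rw [stage_sub, ← integral_reward_add, pow_succ]
  ring

end Play

end StochasticGame

/-! ### The greedy best response -/

open StochasticGame in
theorem mainTheorem1 {N S : Type*} {A : N → Type*} [Fintype N] [DecidableEq N] [Fintype S]
    [∀ j, Fintype (A j)] [∀ j, Nonempty (A j)] (G : StochasticGame N S A)
    (γ : ℝ) (hγ0 : 0 ≤ γ) (hγ1 : γ < 1) (i : N) (K : ℕ)
    (π : ∀ j : {j : N // j ≠ i}, StochasticGame.MemStrategy S A K j) :
    ∃ σ : StochasticGame.MemStrategy S A K i, σ.IsPure ∧
      G.IsBestResponse γ i σ.toStrategy fun j => (π j).toStrategy := by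
  let law : History S A → S → A i → PMF (∀ j, A j) := fun h s b =>
    independent fun j => profile i (fun _ _ => PMF.pure b) (fun j => (π j).toStrategy) j h s
  have hlaw : ∀ h s b, law (h.recent K).1 s b = law h s b := fun h s b => by
    simp only [law]
    congr 1
    funext j
    rcases eq_or_ne j i with rfl | hj
    · simp [profile_self]
    · simp [profile_of_ne _ _ _ hj, MemStrategy.toStrategy, History.recent_recent]
  let L : BoundedHistory S A K × S → A i → (BoundedHistory S A K × S → ℝ) → ℝ := fun x b V =>
    (law x.1.1 x.2 b).expect fun a => G.reward i x.2 a +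
      γ * (G.transition x.2 a).expect fun t => V (History.recent K (x.1.1 ++ List.cons (α := Step S A) (x.2, a) []), t)
  obtain ⟨V, hV⟩ := exists_bellman_fixedPoint L γ hγ0 hγ1 (by
    intro x b V W c hc
    rw [← PMF.expect_sub]
    refine PMF.abs_expect_le _ fun a => ?_
    rw [add_sub_add_left_eq_sub, ← mul_sub, ← PMF.expect_sub, abs_mul, abs_of_nonneg hγ0]
    exact mul_le_mul_of_nonneg_left (PMF.abs_expect_le _ fun t => hc _) hγ0)
  choose hle g hg using hV
  let Q : History S A → S → ℝ := fun h s => V (h.recent K, s)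
  obtain ⟨C, hC⟩ : ∃ C, ∀ h s, |Q h s| ≤ C := by
    obtain ⟨C, hC⟩ := (Set.finite_range fun x => |V x|).bddAbove
    exact ⟨C, fun h s => hC ⟨_, rfl⟩⟩
  -- Only the mixed action `σ h s` may depend on the full history; the values `L` being averaged
  -- depend on the truncated one.
  have hstep : ∀ (σ : Strategy S A i) h s,
      (stepAt (profile i σ fun j => (π j).toStrategy) h s).expect (fun y =>
        G.reward i y.1 y.2 + γ * (G.transition y.1 y.2).expect (Q (h ++ [y]))) =
      (σ h s).expect fun b => L (h.recent K, s) b V := fun σ h s => by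
    rw [expect_stepAt, independent_eq_bind _ i, PMF.expect_bind, profile_self]
    simp only [update_profile_apply, L, hlaw]
    have hQ : ∀ a : ∀ j, A j, Q (h ++ List.cons (α := Step S A) (s, a) []) = fun t =>
        V (History.recent K ((h.recent K).1 ++ List.cons (α := Step S A) (s, a) []), t) :=
      fun a => funext fun t =>
        congrArg (fun m => V (m, t)) (History.recent_append_singleton K h (s, a))
    refine congrArg _ (funext fun b => congrArg _ (funext fun a => ?_))
    exact congrArg (fun q => G.reward i s a + γ * (G.transition s a).expect q) (hQ a)
  have hsum := fun (σ : Strategy S A i) s => G.hasSum_bellman_residual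
    (profile i σ fun j => (π j).toStrategy) s hγ0 hγ1 i Q hC
  simp only [hstep] at hsum
  refine ⟨fun m s => PMF.pure (g (m, s)), fun m s => ⟨_, rfl⟩, fun s σ => ?_⟩
  have hstar := hsum (MemStrategy.toStrategy fun m s => PMF.pure (g (m, s))) s
  simp only [MemStrategy.toStrategy, PMF.expect_pure, hg, Q, sub_self, stage_const, mul_zero]
    at hstar
  have heq := hstar.unique hasSum_zero
  have hdev : 0 ≤ Q [] s - G.utility γ i s (profile i σ fun j => (π j).toStrategy) :=
    -- Each residual is `V` minus an average of values that `hle` bounds by `V`.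
    (hsum σ s).nonneg fun n => mul_nonneg (pow_nonneg hγ0 n) <| by
      rw [← G.stage_const (profile i σ fun j => (π j).toStrategy) s 0 n]
      refine G.stage_mono _ s (fun h t => sub_nonneg.2 ?_) n
      rw [← (σ h t).expect_const (Q h t)]
      exact PMF.expect_mono _ fun b => hle _ b
  exact (sub_nonneg.1 hdev).trans (sub_eq_zero.1 heq).le
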